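/- Let $d\ge 1$, $X=\{1,\dots,d\}^{\mathbb N}$ with the product topology and the shift $\sigma$, let $0<\theta<1$, and let $d_\theta(x,y)=\theta^N$, where $N\ge 1$ is the first index with $x_N\ne y_N$ (and $d_\theta(x,x)=0$). Let $f:X\to(0,\infty)$ be Lipschitz for $d_\theta$. Write $k^n(x)=\sum_{i=0}^{n-1}k(\sigma^i x)$, $\mathrm{Fix}_n=\{x:\sigma^n x=x\}$, $\mathrm{PER}=\bigcup_{n\ge1}\mathrm{Fix}_n$, $P(g)=\lim_{n\to\infty}\frac1n\log\sum_{w\in\{1,\dots,d\}^n}\sup_{x\in[w]}e^{g^n(x)}$ for the topological pressure of a continuous function $g$, where $[w]$ is the set of points whose first $n$ coordinates are $w$, and $\beta(f)=\sup_\nu\int f\,d\nu$, the supremum being over the $\sigma$-invariant Borel probabilities $\nu$. For $c>0$ and $0<s<1$ let $\mu_{c,s}$ be the $\sigma$-invariant Borel probability on $X$ such that, for every continuous $k:X\to\mathbb R$, $$\int k\,d\mu_{c,s}=\frac{\sum_{n=1}^\infty\sum_{x\in \mathrm{Fix}_n}e^{c s f^n(x)-nP(cf)}\,\frac{k^n(x)}{n}}{\sum_{n=1}^\infty\sum_{x\in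 \mathrm{Fix}_n}e^{c s f^n(x)-nP(cf)}}$$ (the series converge and $\mu_{c,s}$ is well defined). For $x\in\mathrm{PER}$ with minimal period $n_x$ let $I(x)=n_x\left(\beta(f)-\frac{f^{n_x}(x)}{n_x}\right)$, and for $x\in X$ let $$\widetilde I(x)=\lim_{\varepsilon\to0^+}\ \inf\{I(y): y\in\mathrm{PER},\ d_\theta(y,x)\le\varepsilon\}\in\mathbb R\cup\{\infty\}.$$ Then this limit exists for every $x\in X$; the function $\widetilde I$ is non-negative and lower semicontinuous; $\widetilde I=I$ on $\mathrm{PER}$; and $\inf_{x\in k}\widetilde I(x)=\inf_{y\in k\cap \mathrm{PER}}I(y)$ for every cylinder $k\subset X$ (a set of all points with prescribed values at finitely many coordinates). Moreover $\mu_{c,s}$ satisfies a large deviation principle on cylinders with rate function $\widetilde I$: let $0<L\le\infty$, and let $c\to\infty$ and $s\to1^-$ (along any sequence, net or filter) in such a way that $c(1-s)\to L$, or only that $\liminf c(1-s)=L$. Then, for every cylinder $k\subset X$, $$\lim\ \frac1c\log\mu_{c,s}(k)=-\inf_{x\in k}\widetilde I(x).$$ -/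

import Mathlib

open Filter Topology MeasureTheory

namespace ZetaShift

/-- The Bernoulli space on `d` symbols with the product topology and the product (= Borel)
σ-algebra. The coordinates `x₁, x₂, …` are `x 0, x 1, …`. -/
abbrev X (d : ℕ) : Type := ℕ → Fin d

/-- The left shift. -/
def shift {d : ℕ} (x : X d) : X d := fun n => x (n + 1)

open Classical in
/-- The metric `d_θ(x, y) = θ ^ N`, where `N ≥ 1` is the position of the first coordinate (counted
from `1`) at which `x` and `y` differ. -/
noncomputable def dTheta {d : ℕ} (θ : ℝ) (x y : X d) : ℝ :=
  if x = y then 0 else θ ^ (PiNat.firstDiff x y + 1)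

/-- The real functions on `X` that are Lipschitz for `d_θ`. -/
def IsLip {d : ℕ} (θ : ℝ) (f : X d → ℝ) : Prop :=
  ∃ C : ℝ, ∀ x y : X d, |f x - f y| ≤ C * dTheta θ x y

/-- The cylinder of the points whose coordinates in the finite set `F` are those of `a`.
For `F = {0, …, m - 1}` it is `[a₁ … a_m]`. -/
def cyl {d : ℕ} (F : Finset ℕ) (a : X d) : Set (X d) := {x | ∀ i ∈ F, x i = a i}

/-- The shift-invariant Borel probabilities. -/
def invProb (d : ℕ) : Set (Measure (X d)) :=
  {ν | IsProbabilityMeasure ν ∧ MeasurePreserving (shift (d := d)) ν ν}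

/-- `β(f)`, the supremum of `∫ f dν` over the invariant probabilities. -/
noncomputable def beta {d : ℕ} (f : X d → ℝ) : ℝ :=
  sSup ((fun ν : Measure (X d) => ∫ x, f x ∂ν) '' invProb d)

/-- The `n`-th partition function `∑_w sup_{x ∈ [w]} exp (gⁿ(x))`, over the words `w` of
length `n`. -/
noncomputable def partitionFn {d : ℕ} (g : X d → ℝ) (n : ℕ) : ℝ :=
  ∑ w : Fin n → Fin d,
    ⨆ x : {x : X d // ∀ i : Fin n, x i = w i}, Real.exp (birkhoffSum shift g n x.1)

/-- The topological pressure of a continuous potential on the full shift: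
the limit of `(1 / n) log ∑_w sup_{[w]} exp gⁿ`. -/
noncomputable def pressure {d : ℕ} (g : X d → ℝ) : ℝ :=
  limsup (fun n : ℕ => Real.log (partitionFn g n) / n) atTop

theorem shift_iterate_apply {d : ℕ} (n : ℕ) (x : X d) (j : ℕ) : shift^[n] x j = x (j + n) := by
  induction n generalizing x j with
  | zero => rfl
  | succ n ih =>
    rw [Function.iterate_succ_apply, ih]
    change x (j + n + 1) = x (j + (n + 1))
    rfl

/-- For `n ≥ 1` the equation `σⁿ(x) = x` has finitely many solutions. -/
theorem finite_fix (d n : ℕ) : {x : X d | shift^[n + 1] x = x}.Finite := by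
  refine Set.Finite.of_injOn (f := fun x : X d => fun i : Fin (n + 1) => x i)
    (t := Set.univ) (fun _ _ => Set.mem_univ _) ?_ Set.finite_univ
  intro x hx y hy hxy
  have key : ∀ z : X d, shift^[n + 1] z = z → ∀ j, z (j + (n + 1)) = z j := fun z hz j => by
    rw [← shift_iterate_apply (n + 1) z j, hz]
  funext j
  induction j using Nat.strong_induction_on with
  | _ j ih =>
    rcases lt_or_ge j (n + 1) with h | h
    · exact congrFun hxy ⟨j, h⟩
    · obtain ⟨k, rfl⟩ := Nat.exists_eq_add_of_le' h
      rw [key x hx, key y hy]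
      exact ih k (by omega)

/-- `Fix_{n+1}`, the set of solutions of `σ^{n+1}(x) = x`. -/
noncomputable def fixSucc (d n : ℕ) : Finset (X d) := (finite_fix d n).toFinset

/-- The weight `exp (c s fⁿ(x) - n P(c f))`. -/
noncomputable def weight {d : ℕ} (f : X d → ℝ) (c s : ℝ) (n : ℕ) (x : X d) : ℝ :=
  Real.exp (c * s * birkhoffSum shift f n x - n * pressure (fun y => c * f y))

/-- The measure `∑_{n ≥ 1} ∑_{x ∈ Fix_n} exp (c s fⁿ(x) - n P(c f)) (1 / n) ∑_{i < n} δ_{σⁱ x}`.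
The summation index is shifted by one. -/
noncomputable def zetaSum {d : ℕ} (f : X d → ℝ) (c s : ℝ) : Measure (X d) :=
  Measure.sum fun n : ℕ => ∑ x ∈ fixSucc d n,
    ENNReal.ofReal (weight f c s (n + 1) x / ((n + 1 : ℕ) : ℝ)) •
      ∑ i ∈ Finset.range (n + 1), Measure.dirac (shift^[i] x)

/-- The probability `μ_{c,s}`: the measure above, normalized. -/
noncomputable def mu {d : ℕ} (f : X d → ℝ) (c s : ℝ) : Measure (X d) :=
  (zetaSum f c s Set.univ)⁻¹ • zetaSum f c s

/-- The set of periodic points. -/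
def Per (d : ℕ) : Set (X d) := Function.periodicPts shift

/-- `I(x) = n_x (β(f) - f^{n_x}(x) / n_x)` for a periodic point `x` of minimal period `n_x`. -/
noncomputable def rateI {d : ℕ} (f : X d → ℝ) (x : Per d) : ℝ :=
  (Function.minimalPeriod shift x.1 : ℝ) *
    (beta f - birkhoffSum shift f (Function.minimalPeriod shift x.1) x.1 /
      (Function.minimalPeriod shift x.1 : ℝ))

/-- `inf {I(y) : y periodic, d_θ(y, x) ≤ ε}`. -/
noncomputable def infBall {d : ℕ} (θ : ℝ) (f : X d → ℝ) (x : X d) (ε : ℝ) : EReal :=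
  ⨅ (y : Per d) (_ : dTheta θ y.1 x ≤ ε), (rateI f y : EReal)

/-- `Ĩ(x)`, the limit as `ε → 0⁺` of `inf {I(y) : d_θ(y, x) ≤ ε}`. Since this infimum increases as
`ε` decreases, the limit is the supremum over `ε > 0`. -/
noncomputable def rateItilde {d : ℕ} (θ : ℝ) (f : X d → ℝ) (x : X d) : EReal :=
  ⨆ (ε : ℝ) (_ : 0 < ε), infBall θ f x ε

end ZetaShift

/-!
Write `P` for the pressure, `β` for `β(f)`, and `K` for a bound on the variation of every Birkhoff
sum `fⁿ` on every cylinder of length `n` (`IsLip.exists_distortion`).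

*The rate function.* Comparison with periodic points gives `fⁿ ≤ n β + K` everywhere
(`birkhoffSum_le_beta_add`). A periodic point `y ≠ x` close to a periodic `x` with `I(x) > 0`
therefore has a large `I(y)`: it pays `I(x)` for each of its many turns along the orbit of `x`, and
regains at most `K` later. Hence `Ĩ = I` on periodic points (`rateItilde_eq_rateI`). Since balls of
`d_θ` are cylinders, semicontinuity and the equality of the infima on cylinders follow.

*Partition sums.* Fekete's lemma gives `n P(g) ≤ log Z_n(g) ≤ n P(g) + K_g`, where `K_g` bounds the
distortion of `g` (`pressure_bounds`), so that the sum of `exp (gⁿ - n P(g))` over `Fix_n` is at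
most `exp K_g`. The excess `P(c f) - c β` is non-negative and decreases with `c`, hence it converges
as `c → ∞` (`exists_tendsto_excess`). It need not tend to `0`.

*Large deviations.* The mass of a cylinder is a quotient of two sums over periodic points
(`mu_cyl`). A single periodic orbit through the cylinder bounds the numerator from below by
`exp (-c I(y) + o(c))`. For the upper bound, split `c = (1 - δ) c + δ c`: the first part yields
`exp (-(1 - δ) c inf I)`, and what remains is the sum for the potential `δ c f`, which over
`Fix_n` is at most `exp (δ c K)`, times `exp (-n r)` with
`r = (excess at c) - (excess at δ c) + c (1 - s) min f`. The difference of the excesses tends to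
`0` while `c (1 - s)` stays away from `0`, so `r` is bounded below and the sum over `n` is bounded
by a geometric series (`weight_le`, `eventually_log_cylMass_le`). Then let `δ → 0`.

The denominator is the numerator for the whole space, so it is negligible provided that the
infimum of `I` over all periodic points is `0`. This is a closing argument along a nearly optimal
orbit (`exists_period_near_beta`).
-/

namespace ZetaShift

/-! ### Birkhoff sums, periodic points and bounded distortion -/

theorem birkhoffSum_mul_left {d : ℕ} (c : ℝ) (f : X d → ℝ) (n : ℕ) (x : X d) :
    birkhoffSum shift (fun y => c * f y) n x = c * birkhoffSum shift f n x := by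
  simp only [birkhoffSum, Finset.mul_sum]

theorem continuous_shift {d : ℕ} : Continuous (shift (d := d)) :=
  continuous_pi fun n => continuous_apply (n + 1)

theorem continuous_birkhoffSum {d : ℕ} {f : X d → ℝ} (hf : Continuous f) (n : ℕ) :
    Continuous (birkhoffSum shift f n) :=
  continuous_finsetSum _ fun i _ => hf.comp (continuous_shift.iterate i)

/-- The point obtained by repeating the first `n` coordinates of `x`. -/
def periodize {d : ℕ} (n : ℕ) (x : X d) : X d := fun i => x (i % n)

theorem periodize_apply {d : ℕ} {n i : ℕ} (x : X d) (h : i < n) : periodize n x i = x i := by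
  rw [periodize, Nat.mod_eq_of_lt h]

theorem shift_iterate_periodize {d : ℕ} (n : ℕ) (x : X d) :
    shift^[n] (periodize n x) = periodize n x := by
  funext j
  rw [shift_iterate_apply, periodize, periodize, Nat.add_mod_right]

theorem birkhoffSum_shift_iterate {d : ℕ} (f : X d → ℝ) {n : ℕ} {x : X d}
    (hx : shift^[n] x = x) (i : ℕ) :
    birkhoffSum shift f n (shift^[i] x) = birkhoffSum shift f n x := by
  induction i with
  | zero => rfl
  | succ i ih =>
    have h := birkhoffSum_apply_sub_birkhoffSum shift f n (shift^[i] x)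
    rw [← Function.iterate_add_apply, add_comm n i, Function.iterate_add_apply, hx, sub_self,
      sub_eq_zero] at h
    rw [Function.iterate_succ_apply', h, ih]

theorem birkhoffSum_mul_period {d : ℕ} (f : X d → ℝ) {p : ℕ} {x : X d}
    (hx : shift^[p] x = x) (q : ℕ) :
    birkhoffSum shift f (q * p) x = q * birkhoffSum shift f p x := by
  induction q with
  | zero => simp
  | succ q ih =>
    rw [Nat.succ_mul, birkhoffSum_add, ih, mul_comm q p, Function.iterate_mul,
      (Function.IsFixedPt.iterate hx q : (shift^[p])^[q] x = x)]
    push_cast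
    ring

/-- `Distortion g K` says that each Birkhoff sum of length `n` varies by at most `K` on each
cylinder of length `n`. -/
def Distortion {d : ℕ} (g : X d → ℝ) (K : ℝ) : Prop :=
  ∀ n x y, (∀ i < n, x i = y i) → |birkhoffSum shift g n x - birkhoffSum shift g n y| ≤ K

theorem Distortion.mul_left {d : ℕ} {g : X d → ℝ} {K : ℝ} (h : Distortion g K) {c : ℝ}
    (hc : 0 ≤ c) : Distortion (fun y => c * g y) (c * K) := fun n x y hxy => by
  rw [birkhoffSum_mul_left, birkhoffSum_mul_left, ← mul_sub, abs_mul, abs_of_nonneg hc]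
  exact mul_le_mul_of_nonneg_left (h n x y hxy) hc

theorem dTheta_le_of_agree {d : ℕ} {θ : ℝ} (hθ0 : 0 < θ) (hθ1 : θ < 1) {N : ℕ} {x y : X d}
    (h : ∀ i < N, x i = y i) : dTheta θ x y ≤ θ ^ (N + 1) := by
  unfold dTheta
  split_ifs with hxy
  · positivity
  · refine pow_le_pow_of_le_one hθ0.le hθ1.le ?_
    by_contra! hlt
    exact PiNat.apply_firstDiff_ne hxy (h _ (by omega))

theorem agree_of_dTheta_le {d : ℕ} {θ : ℝ} (hθ0 : 0 < θ) (hθ1 : θ < 1) {N : ℕ} {x y : X d}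
    (h : dTheta θ x y ≤ θ ^ (N + 1)) : ∀ i < N, x i = y i := by
  intro i hi
  unfold dTheta at h
  split_ifs at h with hxy
  · rw [hxy]
  · refine PiNat.apply_eq_of_lt_firstDiff ?_
    have := (pow_le_pow_iff_right_of_lt_one₀ hθ0 hθ1).1 h
    omega

/-- A Lipschitz function has bounded distortion, and the distortion decreases geometrically in
the number `N` of further coordinates on which the two points agree. -/
theorem IsLip.exists_distortion {d : ℕ} {θ : ℝ} (hθ0 : 0 < θ) (hθ1 : θ < 1) {f : X d → ℝ}
    (hf : IsLip θ f) : ∃ K : ℝ, 0 ≤ K ∧ ∀ n N x y, (∀ i < n + N, x i = y i) →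
      |birkhoffSum shift f n x - birkhoffSum shift f n y| ≤ K * θ ^ N := by
  obtain ⟨C, hC⟩ := hf
  have h1 : 0 < 1 - θ := by linarith
  refine ⟨|C| / (1 - θ), by positivity, fun n => ?_⟩
  -- The difference is at most `∑ |C| θ ^ (N + j)`, summed over `0 ≤ j < n`.
  have key : ∀ N x y, (∀ i < n + N, x i = y i) →
      |birkhoffSum shift f n x - birkhoffSum shift f n y| ≤
        |C| / (1 - θ) * (θ ^ N - θ ^ (N + n)) := by
    induction n with
    | zero => intro N x y _; simp
    | succ n ih =>
      intro N x y h
      rw [birkhoffSum_succ', birkhoffSum_succ', add_sub_add_comm]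
      have h2 := ih N (shift x) (shift y) fun i hi => h (i + 1) (by omega)
      have h3 : |f x - f y| ≤ |C| * θ ^ (n + N) := by
        refine (hC x y).trans ?_
        have hd0 : 0 ≤ dTheta θ x y := by unfold dTheta; split_ifs <;> positivity
        have hd : dTheta θ x y ≤ θ ^ (n + N) :=
          (dTheta_le_of_agree hθ0 hθ1 h).trans
            (pow_le_pow_of_le_one hθ0.le hθ1.le (by omega))
        exact (mul_le_mul_of_nonneg_right (le_abs_self C) hd0).trans
          (mul_le_mul_of_nonneg_left hd (abs_nonneg C))
      have h4 : |C| / (1 - θ) * (θ ^ N - θ ^ (N + n)) + |C| * θ ^ (n + N) =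
          |C| / (1 - θ) * (θ ^ N - θ ^ (N + (n + 1))) := by
        field_simp
        ring
      linarith [abs_add_le (f x - f y)
        (birkhoffSum shift f n (shift x) - birkhoffSum shift f n (shift y))]
  intro N x y h
  refine (key N x y h).trans (mul_le_mul_of_nonneg_left ?_ (by positivity))
  linarith [pow_pos hθ0 (N + n)]

theorem eventually_agree {d : ℕ} (x : X d) (N : ℕ) : ∀ᶠ y in 𝓝 x, ∀ i < N, y i = x i := by
  have h : ∀ i ∈ Finset.range N, ∀ᶠ y in 𝓝 x, y i = x i := fun i _ =>
    (continuous_apply i).continuousAt.eventually_mem ((isOpen_discrete {x i}).mem_nhds rfl)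
  simpa using (Finset.eventually_all _).2 h

theorem continuous_of_distortion {d : ℕ} {θ : ℝ} (hθ0 : 0 < θ) (hθ1 : θ < 1) {f : X d → ℝ} {K : ℝ}
    (hK : ∀ n N x y, (∀ i < n + N, x i = y i) →
      |birkhoffSum shift f n x - birkhoffSum shift f n y| ≤ K * θ ^ N) : Continuous f := by
  refine continuous_iff_continuousAt.2 fun x => Metric.tendsto_nhds.2 fun ε hε => ?_
  have ht : Tendsto (fun N : ℕ => K * θ ^ N) atTop (𝓝 0) := by
    simpa using (tendsto_pow_atTop_nhds_zero_of_lt_one hθ0.le hθ1).const_mul K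
  obtain ⟨N, hN⟩ := (ht.eventually (gt_mem_nhds hε)).exists
  filter_upwards [eventually_agree x (1 + N)] with y hy
  have := hK 1 N y x hy
  rw [birkhoffSum_one, birkhoffSum_one] at this
  exact this.trans_lt hN

/-! ### The pressure -/

theorem bddAbove_exp_birkhoffSum {d : ℕ} {g : X d → ℝ} {K : ℝ} (hg : Distortion g K) {n : ℕ}
    (w : Fin n → Fin d) : BddAbove (Set.range
      fun x : {x : X d // ∀ i : Fin n, x i = w i} => Real.exp (birkhoffSum shift g n x.1)) := by
  by_cases h : Nonempty {x : X d // ∀ i : Fin n, x i = w i}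
  · obtain ⟨x0⟩ := h
    refine ⟨Real.exp (birkhoffSum shift g n x0.1 + K), ?_⟩
    rintro _ ⟨x, rfl⟩
    refine Real.exp_le_exp.2 ?_
    have := hg n x.1 x0.1 fun i hi => (x.2 ⟨i, hi⟩).trans (x0.2 ⟨i, hi⟩).symm
    linarith [le_abs_self (birkhoffSum shift g n x.1 - birkhoffSum shift g n x0.1)]
  · rw [not_nonempty_iff] at h
    simp [Set.range_eq_empty]

/-- The supremum of `exp gⁿ` over the cylinder of the word `w`. -/
noncomputable def cylSup {d : ℕ} (g : X d → ℝ) (n : ℕ) (w : Fin n → Fin d) : ℝ :=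
  ⨆ x : {x : X d // ∀ i : Fin n, x i = w i}, Real.exp (birkhoffSum shift g n x.1)

theorem le_cylSup {d : ℕ} {g : X d → ℝ} {K : ℝ} (hg : Distortion g K) {n : ℕ}
    {w : Fin n → Fin d} {x : X d} (hx : ∀ i : Fin n, x i = w i) :
    Real.exp (birkhoffSum shift g n x) ≤ cylSup g n w :=
  le_ciSup (bddAbove_exp_birkhoffSum hg w) ⟨x, hx⟩

theorem cylSup_nonneg {d : ℕ} (g : X d → ℝ) (n : ℕ) (w : Fin n → Fin d) : 0 ≤ cylSup g n w :=
  Real.iSup_nonneg fun _ => (Real.exp_pos _).le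

theorem cylSup_le {d : ℕ} {g : X d → ℝ} {n : ℕ} {w : Fin n → Fin d} {A : ℝ} (hA : 0 ≤ A)
    (h : ∀ x : X d, (∀ i : Fin n, x i = w i) → Real.exp (birkhoffSum shift g n x) ≤ A) :
    cylSup g n w ≤ A :=
  Real.iSup_le (fun x => h x.1 x.2) hA

/-- Every word occurs: it can be followed by any point. -/
theorem exists_concat {d : ℕ} (y : X d) {n : ℕ} (w : Fin n → Fin d) :
    ∃ x : X d, (∀ i : Fin n, x i = w i) ∧ shift^[n] x = y := by
  refine ⟨fun i => if h : i < n then w ⟨i, h⟩ else y (i - n), fun i => by simp, ?_⟩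
  funext j
  simp [shift_iterate_apply]

theorem partitionFn_add {d : ℕ} (g : X d → ℝ) (m n : ℕ) :
    partitionFn g (m + n) =
      ∑ u : Fin m → Fin d, ∑ v : Fin n → Fin d, cylSup g (m + n) (Fin.append u v) := by
  rw [← Fintype.sum_prod_type']
  exact (Equiv.sum_comp (Fin.appendEquiv m n) (cylSup g (m + n))).symm

theorem agree_append {d m n : ℕ} {u : Fin m → Fin d} {v : Fin n → Fin d} {x : X d} :
    (∀ i : Fin (m + n), x i = Fin.append u v i) ↔
      (∀ i : Fin m, x i = u i) ∧ ∀ i : Fin n, shift^[m] x i = v i := by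
  simp only [shift_iterate_apply]
  rw [Fin.forall_fin_add]
  simp [Fin.append_left, Fin.append_right, add_comm]

theorem partitionFn_add_le {d : ℕ} {g : X d → ℝ} {K : ℝ} (hg : Distortion g K) (m n : ℕ) :
    partitionFn g (m + n) ≤ partitionFn g m * partitionFn g n := by
  rw [partitionFn_add]
  unfold partitionFn
  rw [Finset.sum_mul_sum]
  refine Finset.sum_le_sum fun u _ => Finset.sum_le_sum fun v _ => ?_
  refine cylSup_le (mul_nonneg (cylSup_nonneg g m u) (cylSup_nonneg g n v)) fun x hx => ?_
  rw [agree_append] at hx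
  rw [birkhoffSum_add, Real.exp_add]
  exact mul_le_mul (le_cylSup hg hx.1) (le_cylSup hg hx.2) (Real.exp_pos _).le
    (cylSup_nonneg g m u)

theorem le_partitionFn_add {d : ℕ} {g : X d → ℝ} {K : ℝ} (hg : Distortion g K) (m n : ℕ) :
    partitionFn g m * partitionFn g n ≤ Real.exp K * partitionFn g (m + n) := by
  rw [partitionFn_add]
  unfold partitionFn
  rw [Finset.sum_mul_sum, Finset.mul_sum]
  refine Finset.sum_le_sum fun u _ => ?_
  rw [Finset.mul_sum]
  refine Finset.sum_le_sum fun v _ => ?_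
  change cylSup g m u * cylSup g n v ≤ _
  have h0 := mul_nonneg (Real.exp_pos K).le (cylSup_nonneg g (m + n) (Fin.append u v))
  rw [cylSup, Real.iSup_mul_of_nonneg (cylSup_nonneg g n v)]
  refine Real.iSup_le (fun x => ?_) h0
  rw [cylSup, Real.mul_iSup_of_nonneg (Real.exp_pos _).le]
  refine Real.iSup_le (fun y => ?_) h0
  obtain ⟨z, hz, hzy⟩ := exists_concat y.1 u
  have h1 := le_cylSup hg (agree_append (v := v).2 ⟨hz, fun i => by rw [hzy]; exact y.2 i⟩)
  have h2 := hg m x.1 z fun i hi => (x.2 ⟨i, hi⟩).trans (hz ⟨i, hi⟩).symm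
  rw [birkhoffSum_add, hzy] at h1
  refine le_trans ?_ (mul_le_mul_of_nonneg_left h1 (Real.exp_pos K).le)
  rw [← Real.exp_add, ← Real.exp_add, Real.exp_le_exp]
  linarith [le_abs_self (birkhoffSum shift g m x.1 - birkhoffSum shift g m z)]

theorem exp_le_partitionFn {d : ℕ} {g : X d → ℝ} {K : ℝ} (hg : Distortion g K) (n : ℕ)
    (x : X d) : Real.exp (birkhoffSum shift g n x) ≤ partitionFn g n :=
  (le_cylSup hg (w := fun i : Fin n => x i) fun _ => rfl).trans
    (Finset.single_le_sum (f := cylSup g n) (fun w _ => cylSup_nonneg g n w) (Finset.mem_univ _))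

theorem partitionFn_pos {d : ℕ} [NeZero d] {g : X d → ℝ} {K : ℝ} (hg : Distortion g K) (n : ℕ) :
    0 < partitionFn g n :=
  (Real.exp_pos _).trans_le (exp_le_partitionFn hg n 0)

theorem sum_fixSucc_le_partitionFn {d : ℕ} {g : X d → ℝ} {K : ℝ} (hg : Distortion g K) (n : ℕ) :
    ∑ x ∈ fixSucc d n, Real.exp (birkhoffSum shift g (n + 1) x) ≤ partitionFn g (n + 1) := by
  have hinj : Set.InjOn (fun (x : X d) (i : Fin (n + 1)) => x i) (fixSucc d n) := by
    intro x hx y hy hxy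
    have key : ∀ z ∈ fixSucc d n, z = periodize (n + 1) z := fun z hz => by
      have hz : shift^[n + 1] z = z := by simpa [fixSucc] using hz
      funext j
      have h : z j = z (j % (n + 1)) := by
        conv_lhs => rw [← Nat.mod_add_div j (n + 1)]
        rw [← shift_iterate_apply _ z, Function.iterate_mul,
          (Function.IsFixedPt.iterate hz _ : (shift^[n + 1])^[j / (n + 1)] z = z)]
      exact h
    rw [key x hx, key y hy]
    funext j
    exact congrFun hxy ⟨j % (n + 1), Nat.mod_lt _ n.succ_pos⟩
  classical
  calc ∑ x ∈ fixSucc d n, Real.exp (birkhoffSum shift g (n + 1) x)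
      ≤ ∑ x ∈ fixSucc d n, cylSup g (n + 1) (fun i => x i) :=
        Finset.sum_le_sum fun x _ => le_cylSup hg fun _ => rfl
    _ = ∑ w ∈ (fixSucc d n).image (fun (x : X d) (i : Fin (n + 1)) => x i),
          cylSup g (n + 1) w := (Finset.sum_image hinj).symm
    _ ≤ partitionFn g (n + 1) :=
        Finset.sum_le_univ_sum_of_nonneg fun w => cylSup_nonneg g (n + 1) w

/-- By Fekete's lemma, applied to `log Z_n` and to `K - log Z_n`, the partition functions `Z_n`
grow like `exp (n P)` up to the factor `exp K`. -/
theorem pressure_bounds {d : ℕ} [NeZero d] {g : X d → ℝ} {K : ℝ} (hg : Distortion g K) {n : ℕ}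
    (hn : n ≠ 0) :
    n * pressure g ≤ Real.log (partitionFn g n) ∧
      Real.log (partitionFn g n) ≤ n * pressure g + K := by
  have hsub : Subadditive fun n => Real.log (partitionFn g n) := fun m n => by
    rw [← Real.log_mul (partitionFn_pos hg m).ne' (partitionFn_pos hg n).ne']
    exact Real.log_le_log (partitionFn_pos hg _) (partitionFn_add_le hg m n)
  have hsup : Subadditive fun n => K - Real.log (partitionFn g n) := fun m n => by
    have h := Real.log_le_log (mul_pos (partitionFn_pos hg m) (partitionFn_pos hg n))
      (le_partitionFn_add hg m n)
    rw [Real.log_mul (partitionFn_pos hg m).ne' (partitionFn_pos hg n).ne',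
      Real.log_mul (Real.exp_pos _).ne' (partitionFn_pos hg _).ne', Real.log_exp] at h
    change K - Real.log (partitionFn g (m + n)) ≤
      K - Real.log (partitionFn g m) + (K - Real.log (partitionFn g n))
    linarith
  have hbdd : BddBelow (Set.range fun n : ℕ => Real.log (partitionFn g n) / n) := by
    -- The constant sequence is a fixed point.
    refine ⟨min 0 (g 0), ?_⟩
    rintro _ ⟨m, rfl⟩
    rcases Nat.eq_zero_or_pos m with rfl | hm
    · simp
    · refine (min_le_right _ _).trans ((le_div_iff₀ (by exact_mod_cast hm)).2 ?_)
      have hfix : Function.IsFixedPt (shift (d := d)) 0 := rfl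
      have := Real.log_le_log (Real.exp_pos _) (exp_le_partitionFn hg m 0)
      rw [Real.log_exp, hfix.birkhoffSum_eq, nsmul_eq_mul] at this
      linarith
  have ht := hsub.tendsto_lim hbdd
  have hP : pressure g = hsub.lim := ht.limsup_eq
  rw [← hP] at ht
  have ht' : Tendsto (fun n : ℕ => (K - Real.log (partitionFn g n)) / n) atTop
      (𝓝 (-pressure g)) := by
    have := (tendsto_const_div_atTop_nhds_zero_nat K).sub ht
    simpa [sub_div] using this
  have hlim : hsup.lim = -pressure g :=
    tendsto_nhds_unique (hsup.tendsto_lim ht'.bddBelow_range) ht'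
  have hn' : (0 : ℝ) < n := by positivity
  constructor
  · have := hsub.lim_le_div hbdd hn
    rw [← hP, le_div_iff₀ hn'] at this
    linarith
  · have := hsup.lim_le_div ht'.bddBelow_range hn
    rw [hlim, le_div_iff₀ hn'] at this
    linarith

theorem sum_fixSucc_le {d : ℕ} [NeZero d] {g : X d → ℝ} {K : ℝ} (hg : Distortion g K) (n : ℕ) :
    ∑ x ∈ fixSucc d n, Real.exp (birkhoffSum shift g (n + 1) x - (n + 1 : ℕ) * pressure g) ≤
      Real.exp K := by
  have h := (pressure_bounds hg n.succ_ne_zero).2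
  rw [Real.log_le_iff_le_exp (partitionFn_pos hg _)] at h
  simp only [Real.exp_sub, ← Finset.sum_div]
  rw [div_le_iff₀ (Real.exp_pos _), ← Real.exp_add, add_comm K]
  exact (sum_fixSucc_le_partitionFn hg n).trans h

/-! ### Invariant measures and the maximal average -/

theorem measurable_shift {d : ℕ} : Measurable (shift (d := d)) :=
  measurable_pi_lambda _ fun n => measurable_pi_apply (n + 1)

theorem measurePreserving_orbit {d : ℕ} {n : ℕ} {x : X d} (hx : shift^[n] x = x) :
    MeasurePreserving shift (∑ i ∈ Finset.range n, Measure.dirac (shift^[i] x))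
      (∑ i ∈ Finset.range n, Measure.dirac (shift^[i] x)) := by
  refine ⟨measurable_shift, Measure.ext fun A hA => ?_⟩
  rw [Measure.map_apply measurable_shift hA, Measure.finsetSum_apply, Measure.finsetSum_apply]
  have h : ∀ i, Measure.dirac (shift^[i] x) (shift ⁻¹' A) = Measure.dirac (shift^[i + 1] x) A :=
    fun i => by
      rw [Function.iterate_succ_apply', Measure.dirac_apply' _ (measurable_shift hA),
        Measure.dirac_apply' _ hA]
      exact Set.indicator_comp_right shift (g := fun _ => 1)
  simp only [h]
  cases n with
  | zero => simp only [Finset.range_zero, Finset.sum_empty]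
  | succ m =>
    rw [Finset.sum_range_succ, hx, Finset.sum_range_succ', Function.iterate_zero_apply]

theorem MeasurePreserving.smul_ennreal {d : ℕ} {μ : Measure (X d)}
    (h : MeasurePreserving shift μ μ) (r : ENNReal) : MeasurePreserving shift (r • μ) (r • μ) :=
  ⟨h.measurable, by rw [Measure.map_smul, h.map_eq]⟩

/-- The orbit of a periodic point carries an invariant probability. -/
theorem exists_invProb_of_period {d : ℕ} {f : X d → ℝ} {n : ℕ} (hn : n ≠ 0)
    {x : X d} (hx : shift^[n] x = x) :
    ∃ ν ∈ invProb d, ∫ y, f y ∂ν = birkhoffSum shift f n x / n := by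
  refine ⟨(n : ENNReal)⁻¹ • ∑ i ∈ Finset.range n, Measure.dirac (shift^[i] x),
    ⟨⟨?_⟩, MeasurePreserving.smul_ennreal (measurePreserving_orbit hx) _⟩, ?_⟩
  · rw [Measure.smul_apply, Measure.finsetSum_apply]
    simp only [measure_univ, Finset.sum_const, Finset.card_range, nsmul_eq_mul, mul_one,
      smul_eq_mul]
    exact ENNReal.inv_mul_cancel (by exact_mod_cast hn) (ENNReal.natCast_ne_top n)
  · rw [integral_smul_measure, integral_finsetSum_measure fun i _ => integrable_dirac (by simp)]
    simp only [integral_dirac, birkhoffSum, ENNReal.toReal_inv, ENNReal.toReal_natCast, smul_eq_mul]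
    rw [div_eq_inv_mul]

theorem integrable_of_continuous {d : ℕ} {f : X d → ℝ} (hf : Continuous f) (ν : Measure (X d))
    [IsFiniteMeasure ν] : Integrable f ν :=
  hf.integrable_of_hasCompactSupport (HasCompactSupport.of_compactSpace f)

theorem birkhoffSum_le_beta_of_period {d : ℕ} {f : X d → ℝ} (hf : Continuous f) {n : ℕ}
    (hn : n ≠ 0) {x : X d} (hx : shift^[n] x = x) : birkhoffSum shift f n x ≤ n * beta f := by
  obtain ⟨ν, hν, hint⟩ := exists_invProb_of_period (f := f) hn hx
  have hbdd : BddAbove ((fun ν : Measure (X d) => ∫ x, f x ∂ν) '' invProb d) := by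
    obtain ⟨B, hB⟩ := (isCompact_range hf).bddAbove
    refine ⟨B, ?_⟩
    rintro _ ⟨ρ, ⟨hρ, -⟩, rfl⟩
    have := integral_mono (integrable_of_continuous hf ρ) (integrable_const B)
      fun x => hB (Set.mem_range_self x)
    simpa using this
  have h : ∫ y, f y ∂ν ≤ beta f := le_csSup hbdd (Set.mem_image_of_mem _ hν)
  rw [hint, div_le_iff₀ (by positivity)] at h
  linarith

theorem mul_beta_le {d : ℕ} [NeZero d] {f : X d → ℝ} (hf : Continuous f) {n : ℕ} (hn : n ≠ 0)
    {A : ℝ} (hA : ∀ x, birkhoffSum shift f n x ≤ A) : n * beta f ≤ A := by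
  have hn' : (0 : ℝ) < n := by positivity
  rw [mul_comm, ← le_div_iff₀ hn']
  refine csSup_le ?_ ?_
  · obtain ⟨ν, hν, -⟩ := exists_invProb_of_period (f := f) one_ne_zero (x := (0 : X d)) rfl
    exact ⟨_, Set.mem_image_of_mem _ hν⟩
  · rintro _ ⟨ν, ⟨hν, hinv⟩, rfl⟩
    change ∫ x, f x ∂ν ≤ _
    rw [le_div_iff₀ hn']
    have h1 : ∫ x, birkhoffSum shift f n x ∂ν = n * ∫ x, f x ∂ν := by
      simp only [birkhoffSum]
      have h0 : ∀ i ∈ Finset.range n, Integrable (fun x => f (shift^[i] x)) ν := fun i _ =>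
        integrable_of_continuous (hf.comp (continuous_shift.iterate i)) ν
      rw [integral_finsetSum _ h0]
      have h2 : ∀ i, ∫ x, f (shift^[i] x) ∂ν = ∫ x, f x ∂ν := fun i => by
        have hi := (hinv.iterate i).map_eq
        conv_rhs => rw [← hi]
        rw [integral_map (hinv.iterate i).aemeasurable hf.measurable.aestronglyMeasurable]
      simp [h2]
    have h3 := integral_mono (integrable_of_continuous (continuous_birkhoffSum hf n) ν)
      (integrable_const A) hA
    rw [h1] at h3
    simpa [mul_comm] using h3

theorem Distortion.nonneg {d : ℕ} [NeZero d] {f : X d → ℝ} {K : ℝ} (h : Distortion f K) :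
    0 ≤ K := by
  simpa using h 0 0 0 fun _ _ => rfl

/-- Compare with the periodic point that repeats the first `n` coordinates. -/
theorem birkhoffSum_le_beta_add {d : ℕ} [NeZero d] {f : X d → ℝ} (hf : Continuous f) {K : ℝ}
    (hD : Distortion f K) (n : ℕ) (x : X d) : birkhoffSum shift f n x ≤ n * beta f + K := by
  rcases eq_or_ne n 0 with rfl | hn
  · simpa using hD.nonneg
  · have h1 := birkhoffSum_le_beta_of_period hf hn (shift_iterate_periodize n x)
    have h2 := hD n x (periodize n x) fun i hi => (periodize_apply x hi).symm
    linarith [le_abs_self (birkhoffSum shift f n x - birkhoffSum shift f n (periodize n x))]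

theorem periodize_agree {d p N : ℕ} {z : X d} (h : ∀ i < N, shift^[p] z i = z i) :
    ∀ i < p + N, periodize p z i = z i := by
  intro i
  induction i using Nat.strong_induction_on with
  | _ i ih =>
    intro hi
    rcases lt_or_ge i p with hip | hip
    · exact periodize_apply z hip
    · obtain ⟨l, rfl⟩ := Nat.exists_eq_add_of_le' hip
      have h1 := congrFun (shift_iterate_periodize p z) l
      rw [shift_iterate_apply] at h1
      have h2 := h l (by omega)
      rw [shift_iterate_apply] at h2
      rw [h1, h2]
      rcases Nat.eq_zero_or_pos p with rfl | hp
      · simp [periodize]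
      · exact ih l (by omega) (by omega)

/-- Periodic orbits come arbitrarily close to realizing `n β`, without division by `n`. The sums
`fⁱ(x) - i β` along a long nearly optimal orbit stay bounded, so by the pigeonhole principle two
of them nearly agree at times when the orbit nearly returns; the segment between is closed up. -/
theorem exists_period_near_beta {d : ℕ} [NeZero d] {θ : ℝ} (hθ0 : 0 < θ) (hθ1 : θ < 1)
    {f : X d → ℝ} (hf : Continuous f) {K : ℝ}
    (hK : ∀ n N x y, (∀ i < n + N, x i = y i) →
      |birkhoffSum shift f n x - birkhoffSum shift f n y| ≤ K * θ ^ N)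
    {η : ℝ} (hη : 0 < η) :
    ∃ (p : ℕ) (y : X d), p ≠ 0 ∧ shift^[p] y = y ∧ p * beta f - birkhoffSum shift f p y ≤ η := by
  have hD : Distortion f K := fun n x y h => by simpa using hK n 0 x y h
  have hδ : 0 < η / 2 := half_pos hη
  have ht : Tendsto (fun N : ℕ => K * θ ^ N) atTop (𝓝 0) := by
    simpa using (tendsto_pow_atTop_nhds_zero_of_lt_one hθ0.le hθ1).const_mul K
  obtain ⟨N, hN⟩ := (ht.eventually (gt_mem_nhds hδ)).exists
  let t : Finset ((Fin N → Fin d) × ℤ) :=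
    Finset.univ ×ˢ Finset.Icc ⌊(-1 - K) / (η / 2)⌋ ⌊K / (η / 2)⌋
  obtain ⟨x, hx⟩ : ∃ x, (t.card + 1 : ℕ) * beta f - 1 < birkhoffSum shift f (t.card + 1) x := by
    by_contra! hcon
    linarith [mul_beta_le hf t.card.succ_ne_zero hcon]
  let a : ℕ → ℝ := fun i => birkhoffSum shift f i x - i * beta f
  have hadd : ∀ i p, a (i + p) = a i + (birkhoffSum shift f p (shift^[i] x) - p * beta f) :=
    fun i p => by
      simp only [a, birkhoffSum_add]
      push_cast
      ring
  let Φ : ℕ → (Fin N → Fin d) × ℤ := fun i => (fun j => shift^[i] x j, ⌊a i / (η / 2)⌋)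
  have hΦ : ∀ i ∈ Finset.range (t.card + 1), Φ i ∈ t := fun i hi => by
    have hi' : i < t.card + 1 := Finset.mem_range.1 hi
    have h1 : a i ≤ K := by linarith [birkhoffSum_le_beta_add hf hD i x]
    have h2 : -1 - K ≤ a i := by
      have h3 := hadd i (t.card + 1 - i)
      rw [Nat.add_sub_cancel' hi'.le] at h3
      have h4 : -1 < a (t.card + 1) := by
        change -1 < _ - _
        linarith
      linarith [birkhoffSum_le_beta_add hf hD (t.card + 1 - i) (shift^[i] x)]
    exact Finset.mem_product.2 ⟨Finset.mem_univ _, Finset.mem_Icc.2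
      ⟨Int.floor_le_floor (by gcongr), Int.floor_le_floor (by gcongr)⟩⟩
  obtain ⟨i, j, hij, heq⟩ : ∃ i j, i < j ∧ Φ i = Φ j := by
    obtain ⟨i, -, j, -, hij, heq⟩ :=
      Finset.exists_ne_map_eq_of_card_lt_of_maps_to (by simp) hΦ
    rcases lt_or_gt_of_ne hij with h | h
    exacts [⟨i, j, h, heq⟩, ⟨j, i, h, heq.symm⟩]
  obtain ⟨p, rfl⟩ := Nat.exists_eq_add_of_le hij.le
  have hret : ∀ l < N, shift^[p] (shift^[i] x) l = shift^[i] x l := fun l hl => by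
    have := congrFun (congrArg Prod.fst heq) ⟨l, hl⟩
    rw [← Function.iterate_add_apply, add_comm p]
    exact this.symm
  have hfl : |a i / (η / 2) - a (i + p) / (η / 2)| < 1 :=
    Int.abs_sub_lt_one_of_floor_eq_floor (congrArg Prod.snd heq)
  rw [← sub_div, abs_div, abs_of_pos hδ, div_lt_one hδ] at hfl
  refine ⟨p, periodize p (shift^[i] x), by omega, shift_iterate_periodize _ _, ?_⟩
  have h1 := hK p N _ _ fun l hl => (periodize_agree hret l hl).symm
  have h2 := hadd i p
  linarith [abs_lt.1 hfl, (abs_le.1 (h1.trans hN.le)).2]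

/-! ### The rate functions -/

theorem minimalPeriod_ne_zero {d : ℕ} (x : Per d) : Function.minimalPeriod shift x.1 ≠ 0 :=
  (Function.minimalPeriod_pos_of_mem_periodicPts x.2).ne'

theorem shift_iterate_minimalPeriod {d : ℕ} (x : X d) :
    shift^[Function.minimalPeriod shift x] x = x := Function.iterate_minimalPeriod

theorem mem_per {d n : ℕ} (hn : n ≠ 0) {x : X d} (hx : shift^[n] x = x) : x ∈ Per d :=
  Function.mk_mem_periodicPts (Nat.pos_of_ne_zero hn) hx

theorem rateI_eq {d : ℕ} (f : X d → ℝ) (x : Per d) :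
    rateI f x = Function.minimalPeriod shift x.1 * beta f -
      birkhoffSum shift f (Function.minimalPeriod shift x.1) x.1 := by
  have h : (Function.minimalPeriod shift x.1 : ℝ) ≠ 0 := by
    exact_mod_cast minimalPeriod_ne_zero x
  rw [rateI, mul_sub, mul_div_cancel₀ _ h]

theorem rateI_nonneg {d : ℕ} {f : X d → ℝ} (hf : Continuous f) (x : Per d) : 0 ≤ rateI f x := by
  rw [rateI_eq, sub_nonneg]
  exact birkhoffSum_le_beta_of_period hf (minimalPeriod_ne_zero x)
    (shift_iterate_minimalPeriod x.1)

/-- Any period `n` is a multiple of the minimal one and gives at least the same cost. -/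
theorem rateI_le_of_period {d : ℕ} {f : X d → ℝ} (hf : Continuous f) {n : ℕ} (hn : n ≠ 0)
    (x : Per d) (hx : shift^[n] x.1 = x.1) :
    rateI f x ≤ n * beta f - birkhoffSum shift f n x.1 := by
  obtain ⟨q, hq⟩ := (show Function.IsPeriodicPt shift n x.1 from hx).minimalPeriod_dvd
  have hq0 : (1 : ℝ) ≤ q := by
    have : q ≠ 0 := by
      rintro rfl
      exact hn hq
    exact_mod_cast Nat.one_le_iff_ne_zero.2 this
  have h1 := birkhoffSum_mul_period f (shift_iterate_minimalPeriod x.1) q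
  rw [hq, mul_comm _ q, h1]
  have h2 := rateI_nonneg hf x
  have h3 := rateI_eq f x
  push_cast
  nlinarith

theorem infBall_anti {d : ℕ} (θ : ℝ) (f : X d → ℝ) (x : X d) : Antitone (infBall θ f x) :=
  fun _ _ h => le_iInf₂ fun y hy => iInf₂_le y (hy.trans h)

theorem infBall_le_rateItilde {d : ℕ} (θ : ℝ) (f : X d → ℝ) (x : X d) {ε : ℝ} (hε : 0 < ε) :
    infBall θ f x ε ≤ rateItilde θ f x := le_iSup₂ (f := fun ε (_ : 0 < ε) => infBall θ f x ε) ε hε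

theorem lt_rateItilde_iff {d : ℕ} {θ : ℝ} {f : X d → ℝ} {x : X d} {a : EReal} :
    a < rateItilde θ f x ↔ ∃ ε > 0, a < infBall θ f x ε := by
  simp only [rateItilde, lt_iSup_iff, exists_prop, gt_iff_lt]

theorem tendsto_infBall {d : ℕ} (θ : ℝ) (f : X d → ℝ) (x : X d) :
    Tendsto (fun ε : ℝ => infBall θ f x ε) (𝓝[>] 0) (𝓝 (rateItilde θ f x)) := by
  refine tendsto_order.2 ⟨fun a ha => ?_, fun a ha => ?_⟩
  · obtain ⟨ε, hε, h⟩ := lt_rateItilde_iff.1 ha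
    filter_upwards [Ioo_mem_nhdsGT hε] with r hr
    exact h.trans_le (infBall_anti θ f x hr.2.le)
  · filter_upwards [self_mem_nhdsWithin] with r hr
    exact (infBall_le_rateItilde θ f x hr).trans_lt ha

theorem infBall_nonneg {d : ℕ} (θ : ℝ) {f : X d → ℝ} (hf : Continuous f) (x : X d) (ε : ℝ) :
    0 ≤ infBall θ f x ε :=
  le_iInf₂ fun y _ => by exact_mod_cast rateI_nonneg hf y

theorem rateItilde_nonneg {d : ℕ} (θ : ℝ) {f : X d → ℝ} (hf : Continuous f) (x : X d) :
    0 ≤ rateItilde θ f x :=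
  (infBall_nonneg θ hf x 1).trans (infBall_le_rateItilde θ f x one_pos)

theorem lowerSemicontinuous_rateItilde {d : ℕ} {θ : ℝ} (hθ0 : 0 < θ) (hθ1 : θ < 1)
    (f : X d → ℝ) : LowerSemicontinuous (rateItilde θ f) := by
  intro x a ha
  obtain ⟨ε, hε, h⟩ := lt_rateItilde_iff.1 ha
  obtain ⟨N, hN⟩ := exists_pow_lt_of_lt_one hε hθ1
  -- Balls of `d_θ` are cylinders, so nearby points share the small ball around `x`.
  filter_upwards [eventually_agree x N] with x' hx'
  refine (h.trans_le ?_).trans_le (infBall_le_rateItilde θ f x' (pow_pos hθ0 (N + 1)))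
  refine le_iInf₂ fun y hy => iInf₂_le y ?_
  have hyx : ∀ i < N, y.1 i = x i := fun i hi =>
    (agree_of_dTheta_le hθ0 hθ1 hy i hi).trans (hx' i hi)
  exact ((dTheta_le_of_agree hθ0 hθ1 hyx).trans
    (pow_le_pow_of_le_one hθ0.le hθ1.le N.le_succ)).trans hN.le

theorem finite_small_period (d Q : ℕ) : {y : X d | ∃ n < Q, shift^[n + 1] y = y}.Finite := by
  have : {y : X d | ∃ n < Q, shift^[n + 1] y = y} =
      ⋃ n ∈ Finset.range Q, {y : X d | shift^[n + 1] y = y} := by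
    ext y
    simp
  rw [this]
  exact Set.Finite.biUnion (Finset.finite_toSet _) fun n _ => finite_fix d n

/-- If `I(x) > 0`, a periodic point `y ≠ x` close to `x` has a large period and follows the orbit
of `x` for many turns, each of which costs `I(x)`; the rest of its orbit gains at most `K`. -/
theorem rateItilde_eq_rateI {d : ℕ} [NeZero d] {θ : ℝ} (hθ0 : 0 < θ) (hθ1 : θ < 1)
    {f : X d → ℝ} (hf : Continuous f) {K : ℝ} (hD : Distortion f K) (x : Per d) :
    rateItilde θ f x.1 = (rateI f x : EReal) := by
  refine le_antisymm (iSup₂_le fun ε hε => iInf₂_le x ?_) ?_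
  · simpa [dTheta] using hε.le
  rcases (rateI_nonneg hf x).eq_or_lt with h0 | h0
  · rw [← h0]
    exact rateItilde_nonneg θ hf x.1
  set p := Function.minimalPeriod shift x.1 with hp
  obtain ⟨M, hM⟩ := exists_nat_ge ((rateI f x + 2 * K) / rateI f x)
  rw [div_le_iff₀ h0] at hM
  have hsep : ∀ᶠ ε in 𝓝[>] (0 : ℝ), ∀ y ∈ {y : X d | ∃ n < M * p, shift^[n + 1] y = y},
      y ≠ x.1 → ε < dTheta θ y x.1 := by
    refine (eventually_all_finite (finite_small_period d (M * p))).2 fun y _ => ?_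
    by_cases hy : y = x.1
    · exact .of_forall fun _ h => absurd hy h
    · have hpos : 0 < dTheta θ y x.1 := by
        rw [dTheta, if_neg hy]
        positivity
      filter_upwards [Ioo_mem_nhdsGT hpos] with ε hε _ using hε.2
  have hsmall : ∀ᶠ ε in 𝓝[>] (0 : ℝ), ε ∈ Set.Ioo 0 (θ ^ (M * p + 1)) :=
    Ioo_mem_nhdsGT (pow_pos hθ0 _)
  obtain ⟨ε, hεsep, hε0, hεs⟩ := (hsep.and hsmall).exists
  refine le_trans ?_ (infBall_le_rateItilde θ f x.1 hε0)
  refine le_iInf₂ fun y hy => ?_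
  by_cases hyx : y.1 = x.1
  · rw [Subtype.ext hyx]
  rw [EReal.coe_le_coe_iff, rateI_eq f y]
  set q := Function.minimalPeriod shift y.1 with hq
  have hqM : M * p < q := by
    by_contra! hle
    obtain ⟨n, hn⟩ := Nat.exists_eq_succ_of_ne_zero (minimalPeriod_ne_zero y)
    have hyper := shift_iterate_minimalPeriod y.1
    rw [hn] at hyper
    exact (hεsep y.1 ⟨n, by omega, hyper⟩ hyx).not_ge hy
  obtain ⟨r, hr⟩ := Nat.exists_eq_add_of_le hqM.le
  have h1 := hD (M * p) y.1 x.1 (agree_of_dTheta_le hθ0 hθ1 (hy.trans hεs.le))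
  rw [birkhoffSum_mul_period f (shift_iterate_minimalPeriod x.1) M] at h1
  have h2 := birkhoffSum_le_beta_add hf hD r (shift^[M * p] y.1)
  have h3 := rateI_eq f x
  rw [hr, birkhoffSum_add]
  push_cast
  have h4 : (M : ℝ) * rateI f x = M * p * beta f - M * birkhoffSum shift f p x.1 := by
    rw [h3]
    ring
  linarith [(abs_le.1 h1).2]

theorem mem_cyl_of_agree {d : ℕ} {F : Finset ℕ} {a x y : X d} (hx : x ∈ cyl F a)
    (h : ∀ i < F.sup id + 1, y i = x i) : y ∈ cyl F a := fun i hi =>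
  (h i (Nat.lt_succ_of_le (Finset.le_sup (f := id) hi))).trans (hx i hi)

theorem iInf_rateItilde_cyl {d : ℕ} [NeZero d] {θ : ℝ} (hθ0 : 0 < θ) (hθ1 : θ < 1)
    {f : X d → ℝ} (hf : Continuous f) {K : ℝ} (hD : Distortion f K) (F : Finset ℕ) (a : X d) :
    (⨅ x ∈ cyl F a, rateItilde θ f x) =
      ⨅ (y : Per d) (_ : y.1 ∈ cyl F a), (rateI f y : EReal) := by
  refine le_antisymm (le_iInf₂ fun y hy => ?_) (le_iInf₂ fun x hx => ?_)
  · rw [← rateItilde_eq_rateI hθ0 hθ1 hf hD y]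
    exact iInf₂_le y.1 hy
  · refine le_trans ?_ (infBall_le_rateItilde θ f x (pow_pos hθ0 (F.sup id + 1 + 1)))
    exact le_iInf₂ fun y hy =>
      iInf₂_le y (mem_cyl_of_agree hx (agree_of_dTheta_le hθ0 hθ1 hy))

theorem exists_per_mem_cyl {d : ℕ} (F : Finset ℕ) (a : X d) : ∃ y : Per d, y.1 ∈ cyl F a :=
  ⟨⟨periodize (F.sup id + 1) a, mem_per (Nat.succ_ne_zero _) (shift_iterate_periodize _ a)⟩,
    mem_cyl_of_agree (x := a) (fun _ _ => rfl) fun _ hi => periodize_apply a hi⟩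

/-! ### Pressure at low temperature -/

/-- The difference between the pressure of `c f` and its energy term `c β(f)`. -/
noncomputable def excess {d : ℕ} (f : X d → ℝ) (c : ℝ) : ℝ :=
  pressure (fun y => c * f y) - c * beta f

theorem excess_nonneg {d : ℕ} [NeZero d] {f : X d → ℝ} (hf : Continuous f) {K : ℝ}
    (hD : Distortion f K) {c : ℝ} (hc : 0 < c) : 0 ≤ excess f c := by
  unfold excess
  set P := pressure (fun y => c * f y) with hP
  by_contra! hneg
  obtain ⟨n, hn⟩ := exists_nat_gt (c * K / (c * beta f - P))
  have hpos : 0 < c * beta f - P := by linarith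
  have hDc := hD.mul_left hc.le
  have hn0 : n ≠ 0 := by
    rintro rfl
    have h0 : 0 ≤ c * K / (c * beta f - P) :=
      div_nonneg hDc.nonneg hpos.le
    exact absurd hn (by simpa using h0)
  rw [div_lt_iff₀ hpos] at hn
  have h := mul_beta_le hf hn0 (A := (n * P + c * K) / c) fun x => by
    rw [le_div_iff₀ hc, mul_comm, ← birkhoffSum_mul_left]
    refine le_trans ?_ (pressure_bounds hDc hn0).2
    rw [Real.le_log_iff_exp_le (partitionFn_pos hDc n)]
    exact exp_le_partitionFn hDc n x
  rw [le_div_iff₀ hc] at h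
  nlinarith

theorem excess_anti {d : ℕ} [NeZero d] {f : X d → ℝ} (hf : Continuous f) {K : ℝ}
    (hD : Distortion f K) {b c : ℝ} (hb : 0 < b) (hbc : b ≤ c) : excess f c ≤ excess f b := by
  unfold excess
  have hDb := hD.mul_left hb.le
  have hDc := hD.mul_left (hb.le.trans hbc)
  have key : ∀ n : ℕ, n ≠ 0 → n * pressure (fun y => c * f y) ≤
      n * pressure (fun y => b * f y) + b * K + (c - b) * (n * beta f + K) := fun n hn => by
    have hZ : partitionFn (fun y => c * f y) n ≤
        Real.exp ((c - b) * (n * beta f + K)) * partitionFn (fun y => b * f y) n := by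
      unfold partitionFn
      rw [Finset.mul_sum]
      refine Finset.sum_le_sum fun w _ => cylSup_le
        (mul_nonneg (Real.exp_pos _).le (cylSup_nonneg _ n w)) fun x hx => ?_
      refine le_trans ?_ (mul_le_mul_of_nonneg_left (le_cylSup hDb hx) (Real.exp_pos _).le)
      rw [← Real.exp_add, Real.exp_le_exp, birkhoffSum_mul_left, birkhoffSum_mul_left]
      nlinarith [birkhoffSum_le_beta_add hf hD n x]
    have h := Real.log_le_log (partitionFn_pos hDc n) hZ
    rw [Real.log_mul (Real.exp_pos _).ne' (partitionFn_pos hDb n).ne', Real.log_exp] at h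
    linarith [(pressure_bounds hDc hn).1, (pressure_bounds hDb hn).2]
  by_contra! hlt
  set D := pressure (fun y => c * f y) - c * beta f - (pressure (fun y => b * f y) - b * beta f)
    with hDdef
  have hpos : 0 < D := by linarith
  obtain ⟨n, hn⟩ := exists_nat_gt (c * K / D)
  have hn0 : n ≠ 0 := by
    rintro rfl
    exact absurd hn (by simpa using div_nonneg hDc.nonneg hpos.le)
  rw [div_lt_iff₀ hpos] at hn
  nlinarith [key n hn0]

theorem exists_tendsto_excess {d : ℕ} [NeZero d] {f : X d → ℝ} (hf : Continuous f) {K : ℝ}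
    (hD : Distortion f K) : ∃ h : ℝ, Tendsto (excess f) atTop (𝓝 h) := by
  have hanti : Antitone fun c => excess f (max c 1) := fun b c hbc =>
    excess_anti hf hD (by positivity) (max_le_max_right 1 hbc)
  have hbdd : BddBelow (Set.range fun c => excess f (max c 1)) := by
    refine ⟨0, ?_⟩
    rintro _ ⟨c, rfl⟩
    exact excess_nonneg hf hD (by positivity)
  refine ⟨_, (tendsto_atTop_ciInf hanti hbdd).congr' ?_⟩
  filter_upwards [eventually_ge_atTop 1] with c hc
  rw [max_eq_left hc]

/-! ### Sums over periodic points -/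

theorem mem_fixSucc {d n : ℕ} {x : X d} : x ∈ fixSucc d n ↔ shift^[n + 1] x = x := by
  simp [fixSucc]

theorem mul_le_birkhoffSum {d : ℕ} {f : X d → ℝ} {m : ℝ} (hm : ∀ x, m ≤ f x) (n : ℕ) (x : X d) :
    n * m ≤ birkhoffSum shift f n x := by
  have := Finset.card_nsmul_le_sum (Finset.range n) (fun i => f (shift^[i] x)) m fun i _ => hm _
  simpa [birkhoffSum] using this

/-- Split `c = (1 - δ) c + δ c`: the first part pays for the cost `J`, the second one makes the
sum over the periodic points converge, up to the difference of two excesses, which is small when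
`c` is large and is then absorbed by the factor `exp (-c (1 - s) fⁿ)`. -/
theorem weight_le {d : ℕ} {f : X d → ℝ} {c s δ m r J : ℝ} (hc : 0 < c) (hs : s < 1)
    (hδ : δ ≤ 1) (hm : ∀ x, m ≤ f x)
    (hr : r ≤ excess f c - excess f (δ * c) + c * (1 - s) * m) {n : ℕ} {x : X d}
    (hJ : J ≤ n * beta f - birkhoffSum shift f n x) :
    weight f c s n x ≤ Real.exp (-((1 - δ) * c * J)) * Real.exp (-r) ^ n *
      Real.exp (birkhoffSum shift (fun y => δ * c * f y) n x -
        n * pressure (fun y => δ * c * f y)) := by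
  rw [weight, ← Real.exp_nat_mul, ← Real.exp_add, ← Real.exp_add, Real.exp_le_exp,
    birkhoffSum_mul_left]
  unfold excess at hr
  have h1 := mul_le_mul_of_nonneg_left hJ (mul_nonneg (sub_nonneg.2 hδ) hc.le)
  have h2 := mul_le_mul_of_nonneg_left (mul_le_birkhoffSum hm n x)
    (mul_nonneg hc.le (sub_nonneg.2 hs.le))
  have h3 := mul_le_mul_of_nonneg_left hr n.cast_nonneg
  linarith

open Classical in
theorem sum_weight_le {d : ℕ} [NeZero d] {f : X d → ℝ} {K : ℝ} (hD : Distortion f K)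
    {c s δ m r J : ℝ} (hc : 0 < c) (hs : s < 1) (hδ0 : 0 < δ) (hδ : δ ≤ 1) (hm : ∀ x, m ≤ f x)
    (hr : r ≤ excess f c - excess f (δ * c) + c * (1 - s) * m) {n : ℕ} (A : X d → Prop)
    (hJ : ∀ x ∈ fixSucc d n, A x → J ≤ (n + 1 : ℕ) * beta f - birkhoffSum shift f (n + 1) x) :
    ∑ x ∈ fixSucc d n with A x, weight f c s (n + 1) x ≤
      Real.exp (-((1 - δ) * c * J) + δ * c * K) * Real.exp (-r) ^ (n + 1) := by
  have hpos : 0 ≤ Real.exp (-((1 - δ) * c * J)) * Real.exp (-r) ^ (n + 1) := by positivity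
  refine (Finset.sum_le_sum fun x hx => weight_le hc hs hδ hm hr
    (hJ x (Finset.mem_filter.1 hx).1 (Finset.mem_filter.1 hx).2)).trans ?_
  rw [← Finset.mul_sum, Real.exp_add, mul_right_comm _ (Real.exp (δ * c * K))]
  refine mul_le_mul_of_nonneg_left ?_ hpos
  refine le_trans (Finset.sum_le_sum_of_subset_of_nonneg (Finset.filter_subset _ _)
    fun x _ _ => (Real.exp_pos _).le) ?_
  exact sum_fixSucc_le (hD.mul_left (mul_pos hδ0 hc).le) n

theorem summable_exp_neg_pow {r : ℝ} (hr : 0 < r) :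
    Summable fun n : ℕ => Real.exp (-r) ^ (n + 1) :=
  (summable_nat_add_iff 1).2
    (summable_geometric_of_lt_one (Real.exp_pos _).le
      ((Real.exp_lt_exp.2 (neg_lt_zero.2 hr)).trans_eq Real.exp_zero))

theorem weight_pos {d : ℕ} (f : X d → ℝ) (c s : ℝ) (n : ℕ) (x : X d) : 0 < weight f c s n x :=
  Real.exp_pos _

theorem summable_weight {d : ℕ} [NeZero d] {f : X d → ℝ} {K m : ℝ}
    (hD : Distortion f K) (hm0 : 0 < m) (hm : ∀ x, m ≤ f x) {c s : ℝ} (hc : 0 < c) (hs : s < 1) :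
    Summable fun n : ℕ => ∑ x ∈ fixSucc d n, weight f c s (n + 1) x := by
  classical
  have hr : 0 < c * (1 - s) * m := mul_pos (mul_pos hc (by linarith)) hm0
  refine Summable.of_nonneg_of_le (fun n => Finset.sum_nonneg fun x _ => (weight_pos f c s _ x).le)
    (fun n => ?_) ((summable_exp_neg_pow hr).mul_left (Real.exp (1 * c * K)))
  -- With `δ = 1` the value of `J` does not matter: any lower bound on the finite set `Fix` serves.
  obtain ⟨J, hJ⟩ := ((fixSucc d n).finite_toSet.image
    fun x => (n + 1 : ℕ) * beta f - birkhoffSum shift f (n + 1) x).bddBelow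
  have h := sum_weight_le hD hc hs one_pos le_rfl hm (r := c * (1 - s) * m) (by simp)
    (fun _ => True) (J := J) fun x hx _ => hJ (Set.mem_image_of_mem _ hx)
  simpa using h

/-! ### The measure `μ_{c,s}` -/

theorem zetaSum_univ {d : ℕ} (f : X d → ℝ) {c s : ℝ}
    (hsum : Summable fun n : ℕ => ∑ x ∈ fixSucc d n, weight f c s (n + 1) x) :
    zetaSum f c s Set.univ =
      ENNReal.ofReal (∑' n : ℕ, ∑ x ∈ fixSucc d n, weight f c s (n + 1) x) := by
  rw [ENNReal.ofReal_tsum_of_nonneg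
    (fun n => Finset.sum_nonneg fun x _ => (weight_pos f c s _ x).le) hsum, zetaSum,
    Measure.sum_apply _ MeasurableSet.univ]
  congr 1
  funext n
  rw [Measure.finsetSum_apply,
    ENNReal.ofReal_sum_of_nonneg fun x _ => (weight_pos f c s _ x).le]
  refine Finset.sum_congr rfl fun x _ => ?_
  rw [Measure.smul_apply, Measure.finsetSum_apply]
  simp only [measure_univ, Finset.sum_const, Finset.card_range, nsmul_eq_mul, mul_one, smul_eq_mul]
  rw [← ENNReal.ofReal_natCast, ← ENNReal.ofReal_mul
    (div_nonneg (weight_pos f c s _ x).le (Nat.cast_nonneg _)), div_mul_cancel₀]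
  exact_mod_cast n.succ_ne_zero

theorem measurePreserving_zetaSum {d : ℕ} (f : X d → ℝ) (c s : ℝ) :
    MeasurePreserving shift (zetaSum f c s) (zetaSum f c s) := by
  refine ⟨measurable_shift, Measure.ext fun A hA => ?_⟩
  rw [Measure.map_apply measurable_shift hA, zetaSum,
    Measure.sum_apply _ (measurable_shift hA), Measure.sum_apply _ hA]
  congr 1
  funext n
  rw [Measure.finsetSum_apply, Measure.finsetSum_apply]
  refine Finset.sum_congr rfl fun x hx => ?_
  rw [Measure.smul_apply, Measure.smul_apply,
    (measurePreserving_orbit (mem_fixSucc.1 hx)).measure_preimage hA.nullMeasurableSet]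

theorem integral_zetaSum {d : ℕ} (f : X d → ℝ) {c s : ℝ} [IsFiniteMeasure (zetaSum f c s)]
    {k : X d → ℝ} (hk : Continuous k) :
    ∫ x, k x ∂(zetaSum f c s) = ∑' n : ℕ, ∑ x ∈ fixSucc d n,
      weight f c s (n + 1) x * (birkhoffSum shift k (n + 1) x / ((n + 1 : ℕ) : ℝ)) := by
  have hint : Integrable k (zetaSum f c s) := integrable_of_continuous hk _
  unfold zetaSum at hint ⊢
  rw [integral_sum_measure hint]
  refine tsum_congr fun n => ?_
  have hdirac : ∀ x : X d, Integrable k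
      (∑ i ∈ Finset.range (n + 1), Measure.dirac (shift^[i] x)) := fun x =>
    integrable_finsetSum_measure.2 fun i _ => integrable_dirac (by simp)
  rw [integral_finsetSum_measure fun x _ => (hdirac x).smul_measure ENNReal.ofReal_ne_top]
  refine Finset.sum_congr rfl fun x _ => ?_
  rw [integral_smul_measure, integral_finsetSum_measure fun i _ => integrable_dirac (by simp),
    ENNReal.toReal_ofReal (div_nonneg (weight_pos f c s _ x).le (Nat.cast_nonneg _))]
  simp only [integral_dirac, birkhoffSum, smul_eq_mul]
  ring

theorem tsum_weight_pos {d : ℕ} [NeZero d] {f : X d → ℝ} {c s : ℝ}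
    (hsum : Summable fun n : ℕ => ∑ x ∈ fixSucc d n, weight f c s (n + 1) x) :
    0 < ∑' n : ℕ, ∑ x ∈ fixSucc d n, weight f c s (n + 1) x :=
  hsum.tsum_pos (fun _ => Finset.sum_nonneg fun x _ => (weight_pos f c s _ x).le) 0
    (Finset.sum_pos (fun x _ => weight_pos f c s _ x) ⟨0, mem_fixSucc.2 rfl⟩)

theorem mu_mem_invProb {d : ℕ} [NeZero d] {f : X d → ℝ} {c s : ℝ}
    (hsum : Summable fun n : ℕ => ∑ x ∈ fixSucc d n, weight f c s (n + 1) x) :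
    mu f c s ∈ invProb d := by
  refine ⟨⟨?_⟩, MeasurePreserving.smul_ennreal (measurePreserving_zetaSum f c s) _⟩
  rw [mu, Measure.smul_apply, smul_eq_mul, zetaSum_univ f hsum]
  exact ENNReal.inv_mul_cancel (ENNReal.ofReal_pos.2 (tsum_weight_pos hsum)).ne'
    ENNReal.ofReal_ne_top

theorem integral_mu {d : ℕ} {f : X d → ℝ} {c s : ℝ}
    (hsum : Summable fun n : ℕ => ∑ x ∈ fixSucc d n, weight f c s (n + 1) x)
    {k : X d → ℝ} (hk : Continuous k) :
    ∫ x, k x ∂(mu f c s) =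
      (∑' n : ℕ, ∑ x ∈ fixSucc d n, weight f c s (n + 1) x *
          (birkhoffSum shift k (n + 1) x / ((n + 1 : ℕ) : ℝ))) /
        ∑' n : ℕ, ∑ x ∈ fixSucc d n, weight f c s (n + 1) x := by
  have : IsFiniteMeasure (zetaSum f c s) := ⟨by
    rw [zetaSum_univ f hsum]
    exact ENNReal.ofReal_lt_top⟩
  rw [mu, integral_smul_measure, integral_zetaSum f hk, zetaSum_univ f hsum, ENNReal.toReal_inv,
    ENNReal.toReal_ofReal (tsum_nonneg
      fun n => Finset.sum_nonneg fun x _ => (weight_pos f c s _ x).le), smul_eq_mul,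
    div_eq_inv_mul]

/-! ### Large deviations -/

/-- The unnormalized mass that `μ_{c,s}` gives to `A`. -/
noncomputable def cylMass {d : ℕ} (f : X d → ℝ) (A : Set (X d)) (c s : ℝ) : ℝ :=
  ∑' n : ℕ, ∑ x ∈ fixSucc d n, weight f c s (n + 1) x *
    (birkhoffSum shift (A.indicator fun _ => (1 : ℝ)) (n + 1) x / ((n + 1 : ℕ) : ℝ))

theorem birkhoffSum_indicator_nonneg {d : ℕ} (A : Set (X d)) (n : ℕ) (x : X d) :
    0 ≤ birkhoffSum shift (A.indicator fun _ => (1 : ℝ)) n x :=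
  Finset.sum_nonneg fun _ _ => Set.indicator_nonneg (fun _ _ => zero_le_one) _

open Classical in
theorem weight_mul_le {d : ℕ} (f : X d → ℝ) (A : Set (X d)) (c s : ℝ) (n : ℕ) :
    ∑ x ∈ fixSucc d n, weight f c s (n + 1) x *
      (birkhoffSum shift (A.indicator fun _ => (1 : ℝ)) (n + 1) x / ((n + 1 : ℕ) : ℝ)) ≤
    ∑ x ∈ fixSucc d n with ∃ i, shift^[i] x ∈ A, weight f c s (n + 1) x := by
  rw [Finset.sum_filter]
  refine Finset.sum_le_sum fun x _ => ?_
  split_ifs with h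
  · refine mul_le_of_le_one_right (weight_pos f c s _ x).le
      (div_le_one_of_le₀ ?_ (Nat.cast_nonneg _))
    have := Finset.sum_le_card_nsmul (Finset.range (n + 1))
      (fun i => A.indicator (fun _ => (1 : ℝ)) (shift^[i] x)) 1
      fun i _ => Set.indicator_le_self' (fun _ _ => zero_le_one) _
    simpa [birkhoffSum] using this
  · have h0 : birkhoffSum shift (A.indicator fun _ => (1 : ℝ)) (n + 1) x = 0 :=
      Finset.sum_eq_zero fun i _ => Set.indicator_of_notMem (fun hi => h ⟨i, hi⟩) _
    rw [h0, zero_div, mul_zero]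

theorem weight_mul_nonneg {d : ℕ} (f : X d → ℝ) (A : Set (X d)) (c s : ℝ) (n : ℕ) (x : X d) :
    0 ≤ weight f c s (n + 1) x *
      (birkhoffSum shift (A.indicator fun _ => (1 : ℝ)) (n + 1) x / ((n + 1 : ℕ) : ℝ)) :=
  mul_nonneg (weight_pos f c s _ x).le
    (div_nonneg (birkhoffSum_indicator_nonneg A _ x) (Nat.cast_nonneg _))

theorem summable_weight_mul {d : ℕ} {f : X d → ℝ} {c s : ℝ}
    (hsum : Summable fun n : ℕ => ∑ x ∈ fixSucc d n, weight f c s (n + 1) x) (A : Set (X d)) :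
    Summable fun n : ℕ => ∑ x ∈ fixSucc d n, weight f c s (n + 1) x *
      (birkhoffSum shift (A.indicator fun _ => (1 : ℝ)) (n + 1) x / ((n + 1 : ℕ) : ℝ)) := by
  classical
  exact Summable.of_nonneg_of_le
    (fun n => Finset.sum_nonneg fun x _ => weight_mul_nonneg f A c s n x)
    (fun n => (weight_mul_le f A c s n).trans (Finset.sum_le_sum_of_subset_of_nonneg
      (Finset.filter_subset _ _) fun x _ _ => (weight_pos f c s _ x).le)) hsum

theorem cylMass_univ {d : ℕ} (f : X d → ℝ) (c s : ℝ) :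
    cylMass f Set.univ c s = ∑' n : ℕ, ∑ x ∈ fixSucc d n, weight f c s (n + 1) x := by
  refine tsum_congr fun n => Finset.sum_congr rfl fun x _ => ?_
  have h : birkhoffSum shift (Set.univ.indicator fun _ => (1 : ℝ)) (n + 1) x = (n + 1 : ℕ) := by
    simp [birkhoffSum]
  rw [h, div_self (Nat.cast_ne_zero.2 n.succ_ne_zero), mul_one]

theorem weight_div_le_cylMass {d : ℕ} {f : X d → ℝ} {c s : ℝ}
    (hsum : Summable fun n : ℕ => ∑ x ∈ fixSucc d n, weight f c s (n + 1) x) {A : Set (X d)}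
    {y : X d} (hyA : y ∈ A) {p : ℕ} (hp : p ≠ 0) (hy : shift^[p] y = y) :
    weight f c s p y / p ≤ cylMass f A c s := by
  obtain ⟨n, rfl⟩ := Nat.exists_eq_succ_of_ne_zero hp
  refine le_trans ?_ ((summable_weight_mul hsum A).le_tsum n
    fun j _ => Finset.sum_nonneg fun x _ => weight_mul_nonneg f A c s j x)
  refine le_trans ?_ (Finset.single_le_sum (fun x _ => weight_mul_nonneg f A c s n x)
    (mem_fixSucc.2 hy))
  rw [← mul_div_assoc]
  refine div_le_div_of_nonneg_right (le_mul_of_one_le_right (weight_pos f c s _ y).le ?_)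
    (Nat.cast_nonneg _)
  rw [birkhoffSum_succ', Set.indicator_of_mem hyA]
  exact le_add_of_nonneg_right (birkhoffSum_indicator_nonneg A n _)

theorem cylMass_pos {d : ℕ} {f : X d → ℝ} {c s : ℝ}
    (hsum : Summable fun n : ℕ => ∑ x ∈ fixSucc d n, weight f c s (n + 1) x) {A : Set (X d)}
    (hA : ∃ y : Per d, y.1 ∈ A) : 0 < cylMass f A c s := by
  obtain ⟨y, hy⟩ := hA
  have hp := minimalPeriod_ne_zero y
  refine lt_of_lt_of_le ?_
    (weight_div_le_cylMass hsum hy hp (shift_iterate_minimalPeriod y.1))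
  exact div_pos (weight_pos f c s _ _) (by positivity)

theorem continuous_indicator_cyl {d : ℕ} (F : Finset ℕ) (a : X d) :
    Continuous ((cyl F a).indicator fun _ => (1 : ℝ)) := by
  have h : IsClopen (cyl F a) := by
    have : cyl F a = ⋂ i ∈ F, (fun x : X d => x i) ⁻¹' {a i} := by
      ext x
      simp [cyl]
    rw [this]
    exact F.finite_toSet.isClopen_biInter fun i _ =>
      (isClopen_discrete {a i}).preimage (continuous_apply i)
  exact h.continuous_indicator continuous_const

theorem mu_cyl {d : ℕ} [NeZero d] {f : X d → ℝ} {c s : ℝ}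
    (hsum : Summable fun n : ℕ => ∑ x ∈ fixSucc d n, weight f c s (n + 1) x)
    (F : Finset ℕ) (a : X d) :
    mu f c s (cyl F a) =
      ENNReal.ofReal (cylMass f (cyl F a) c s / cylMass f Set.univ c s) := by
  have : IsProbabilityMeasure (mu f c s) := (mu_mem_invProb hsum).1
  have hmeas : MeasurableSet (cyl F a) := by
    have h := (continuous_indicator_cyl F a).measurable (measurableSet_singleton 1)
    have h2 : (cyl F a).indicator (fun _ => (1 : ℝ)) ⁻¹' {1} = cyl F a := by
      ext x
      by_cases hx : x ∈ cyl F a <;> simp [hx]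
    rwa [h2] at h
  have h := integral_mu hsum (continuous_indicator_cyl F a)
  rw [integral_indicator_const _ hmeas, smul_eq_mul, mul_one] at h
  rw [cylMass_univ, cylMass, ← h, ofReal_measureReal]

/-- The upper bound: for each `δ` the sum over the orbits that meet `A` is at most
`exp (-(1 - δ) c J + δ c K)` up to a constant factor. -/
theorem eventually_log_cylMass_le {d : ℕ} [NeZero d] {f : X d → ℝ} (hf : Continuous f) {K m : ℝ}
    (hD : Distortion f K) (hm0 : 0 < m) (hm : ∀ x, m ≤ f x) {A : Set (X d)} {J : ℝ} (hJ0 : 0 ≤ J)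
    (hAne : ∃ y : Per d, y.1 ∈ A) (hJ : ∀ y : Per d, y.1 ∈ A → J ≤ rateI f y)
    {ι : Type*} {l : Filter ι} {c s : ι → ℝ} (hc : Tendsto c l atTop) (hs : ∀ᶠ i in l, s i < 1)
    {L : ℝ} (hL : 0 < L) (hcs : ∀ᶠ i in l, L ≤ c i * (1 - s i)) {η : ℝ} (hη : 0 < η) :
    ∀ᶠ i in l, Real.log (cylMass f A (c i) (s i)) / c i ≤ -J + η := by
  classical
  have hK0 := hD.nonneg
  set δ := η / (2 * (J + K + η)) with hδdef
  have hδ0 : 0 < δ := by positivity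
  have hδ1 : δ ≤ 1 := (div_le_one (by positivity)).2 (by linarith)
  have hδη : δ * (J + K) ≤ η / 2 := by
    rw [hδdef, div_mul_eq_mul_div, div_le_div_iff₀ (by positivity) two_pos]
    nlinarith
  obtain ⟨h, hh⟩ := exists_tendsto_excess hf hD
  have hex : Tendsto (fun i => excess f (c i) - excess f (δ * c i)) l (𝓝 0) := by
    simpa using (hh.comp hc).sub (hh.comp (hc.const_mul_atTop hδ0))
  set r := L * m / 2 with hr
  have hr0 : 0 < r := by positivity
  set G := ∑' n : ℕ, Real.exp (-r) ^ (n + 1) with hG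
  have hG0 : 0 < G := (summable_exp_neg_pow hr0).tsum_pos (fun n => by positivity) 0 (by positivity)
  have hlogG : Tendsto (fun i => Real.log G / c i) l (𝓝 0) := hc.const_div_atTop _
  filter_upwards [hc.eventually_gt_atTop 0, hs, hcs,
    hex.eventually (lt_mem_nhds (neg_lt_zero.2 hr0)), hlogG.eventually (gt_mem_nhds (half_pos hη))]
    with i hci hsi hcsi hexi hGi
  have hsum := summable_weight hD hm0 hm hci hsi
  have hle : cylMass f A (c i) (s i) ≤
      Real.exp (-((1 - δ) * c i * J) + δ * c i * K) * G := by
    rw [hG, ← tsum_mul_left]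
    refine (summable_weight_mul hsum A).tsum_le_tsum (fun n => (weight_mul_le f A _ _ n).trans ?_)
      ((summable_exp_neg_pow hr0).mul_left _)
    refine sum_weight_le hD hci hsi hδ0 hδ1 hm ?_ _ ?_
    · nlinarith [mul_le_mul_of_nonneg_right hcsi hm0.le]
    · rintro x hx ⟨j, hj⟩
      rw [mem_fixSucc] at hx
      have hjper : shift^[n + 1] (shift^[j] x) = shift^[j] x := by
        rw [← Function.iterate_add_apply, add_comm, Function.iterate_add_apply, hx]
      refine (hJ ⟨_, mem_per n.succ_ne_zero hjper⟩ hj).trans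
        ((rateI_le_of_period hf n.succ_ne_zero _ hjper).trans_eq ?_)
      rw [birkhoffSum_shift_iterate f hx]
  have hlog := Real.log_le_log (cylMass_pos hsum hAne) hle
  rw [Real.log_mul (Real.exp_pos _).ne' hG0.ne', Real.log_exp] at hlog
  rw [div_lt_iff₀ hci] at hGi
  rw [div_le_iff₀ hci]
  nlinarith [mul_le_mul_of_nonneg_right hδη hci.le]

/-- The lower bound: a single periodic orbit through `A` contributes `exp (-c I(y))` up to
factors that are negligible on the exponential scale. -/
theorem eventually_le_log_cylMass {d : ℕ} [NeZero d] {f : X d → ℝ} (hf : Continuous f) {K m : ℝ}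
    (hD : Distortion f K) (hm0 : 0 < m) (hm : ∀ x, m ≤ f x) {A : Set (X d)} (y : Per d)
    (hy : y.1 ∈ A) {ι : Type*} {l : Filter ι} {c s : ι → ℝ} (hc : Tendsto c l atTop)
    (hs : Tendsto s l (𝓝[<] 1)) {η : ℝ} (hη : 0 < η) :
    ∀ᶠ i in l, -rateI f y - η ≤ Real.log (cylMass f A (c i) (s i)) / c i := by
  obtain ⟨h, hh⟩ := exists_tendsto_excess hf hD
  have hIy := rateI_eq f y
  have hp0 := minimalPeriod_ne_zero y
  have hper := shift_iterate_minimalPeriod y.1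
  set p := Function.minimalPeriod shift y.1 with hp
  have hs1 : Tendsto s l (𝓝 1) := hs.mono_right nhdsWithin_le_nhds
  have herr : Tendsto (fun i => (1 - s i) * birkhoffSum shift f p y.1 +
      (p * excess f (c i) + Real.log p) / c i) l (𝓝 0) := by
    have h1 : Tendsto (fun i => (1 - s i) * birkhoffSum shift f p y.1) l (𝓝 0) := by
      simpa using (hs1.const_sub 1).mul_const (birkhoffSum shift f p y.1)
    have h2 := (((hh.comp hc).const_mul (p : ℝ)).add_const (Real.log p)).div_atTop hc
    simpa using h1.add h2
  filter_upwards [hc.eventually_gt_atTop 0, hs.eventually self_mem_nhdsWithin,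
    herr.eventually (gt_mem_nhds hη)] with i hci hsi herri
  have hsum := summable_weight hD hm0 hm hci hsi
  have hp' : (0 : ℝ) < p := by positivity
  have hlog := Real.log_le_log (div_pos (weight_pos f (c i) (s i) p y.1) hp')
    (weight_div_le_cylMass hsum hy hp0 hper)
  rw [Real.log_div (weight_pos f _ _ p y.1).ne' hp'.ne', weight, Real.log_exp] at hlog
  rw [le_div_iff₀ hci]
  have herr2 := mul_lt_mul_of_pos_right herri hci
  rw [add_mul, div_mul_cancel₀ _ hci.ne', excess] at herr2
  rw [hIy]
  nlinarith

theorem tendsto_log_cylMass {d : ℕ} [NeZero d] {f : X d → ℝ} (hf : Continuous f) {K m : ℝ}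
    (hD : Distortion f K) (hm0 : 0 < m) (hm : ∀ x, m ≤ f x) {A : Set (X d)} {J : ℝ}
    (hAne : ∃ y : Per d, y.1 ∈ A) (hJ : IsGLB (rateI f '' {y : Per d | y.1 ∈ A}) J)
    {ι : Type*} {l : Filter ι} {c s : ι → ℝ} (hc : Tendsto c l atTop) (hs : Tendsto s l (𝓝[<] 1))
    {L : ℝ} (hL : 0 < L) (hcs : ∀ᶠ i in l, L ≤ c i * (1 - s i)) :
    Tendsto (fun i => Real.log (cylMass f A (c i) (s i)) / c i) l (𝓝 (-J)) := by
  have hJ0 : 0 ≤ J := hJ.2 (by rintro _ ⟨y, -, rfl⟩; exact rateI_nonneg hf y)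
  refine tendsto_order.2 ⟨fun a ha => ?_, fun a ha => ?_⟩
  · obtain ⟨_, ⟨y, hy, rfl⟩, hyJ⟩ := (isGLB_lt_iff hJ).1 (show J < -a by linarith)
    filter_upwards [eventually_le_log_cylMass hf hD hm0 hm (A := A) y hy hc hs
      (show 0 < (-a - rateI f y) / 2 by linarith)] with i hi
    linarith
  · filter_upwards [eventually_log_cylMass_le hf hD hm0 hm hJ0 hAne
      (fun y hy => hJ.1 (Set.mem_image_of_mem _ hy)) hc (hs.eventually self_mem_nhdsWithin) hL hcs
      (show 0 < (a + J) / 2 by linarith)] with i hi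
    linarith

theorem isGLB_rateI_univ {d : ℕ} [NeZero d] {θ : ℝ} (hθ0 : 0 < θ) (hθ1 : θ < 1)
    {f : X d → ℝ} (hf : Continuous f) {K : ℝ}
    (hK : ∀ n N x y, (∀ i < n + N, x i = y i) →
      |birkhoffSum shift f n x - birkhoffSum shift f n y| ≤ K * θ ^ N) :
    IsGLB (rateI f '' {y : Per d | y.1 ∈ Set.univ}) 0 := by
  refine ⟨by rintro _ ⟨y, -, rfl⟩; exact rateI_nonneg hf y, fun b hb => ?_⟩
  refine le_of_forall_pos_le_add fun η hη => ?_
  obtain ⟨p, y, hp, hy, hle⟩ := exists_period_near_beta hθ0 hθ1 hf hK hη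
  rw [zero_add]
  exact (hb (Set.mem_image_of_mem _ (show (⟨y, mem_per hp hy⟩ : Per d) ∈ _ from
    Set.mem_univ y))).trans ((rateI_le_of_period hf hp _ hy).trans hle)

theorem iInf_coe_eq_of_isGLB {α : Type*} {S : Set α} {I : α → ℝ} {J : ℝ} (hJ : IsGLB (I '' S) J) :
    ⨅ (y : α) (_ : y ∈ S), (I y : EReal) = (J : EReal) := by
  refine le_antisymm ?_ (le_iInf₂ fun y hy =>
    EReal.coe_le_coe_iff.2 (hJ.1 (Set.mem_image_of_mem I hy)))
  by_contra! hlt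
  obtain ⟨t, hJt, ht⟩ := EReal.lt_iff_exists_real_btwn.1 hlt
  obtain ⟨_, ⟨y, hy, rfl⟩, hyt⟩ := (isGLB_lt_iff hJ).1 (EReal.coe_lt_coe_iff.1 hJt)
  exact ((iInf₂_le y hy).trans_lt (EReal.coe_lt_coe_iff.2 hyt)).not_gt ht

theorem tendsto_log_mu_cyl {d : ℕ} [NeZero d] {θ : ℝ} (hθ0 : 0 < θ) (hθ1 : θ < 1)
    {f : X d → ℝ} (hf : Continuous f) {K m : ℝ}
    (hK : ∀ n N x y, (∀ i < n + N, x i = y i) →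
      |birkhoffSum shift f n x - birkhoffSum shift f n y| ≤ K * θ ^ N)
    (hm0 : 0 < m) (hm : ∀ x, m ≤ f x) {ι : Type*} {l : Filter ι} {c s : ι → ℝ}
    (hc : Tendsto c l atTop) (hs : Tendsto s l (𝓝[<] 1))
    {L : ℝ} (hL : 0 < L) (hcs : ∀ᶠ i in l, L ≤ c i * (1 - s i)) (F : Finset ℕ) (a : X d) :
    Tendsto (fun i => ((1 / c i : ℝ) : EReal) * ENNReal.log (mu f (c i) (s i) (cyl F a))) l
      (𝓝 (-(⨅ x ∈ cyl F a, rateItilde θ f x))) := by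
  have hD : Distortion f K := fun n x y h => by simpa using hK n 0 x y h
  obtain ⟨y0, hy0⟩ := exists_per_mem_cyl F a
  have hne : (rateI f '' {y : Per d | y.1 ∈ cyl F a}).Nonempty :=
    ⟨_, Set.mem_image_of_mem _ (show y0 ∈ {y : Per d | y.1 ∈ cyl F a} from hy0)⟩
  have hJ := isGLB_csInf hne
    ⟨0, by rintro _ ⟨y, -, rfl⟩; exact rateI_nonneg hf y⟩
  set J := sInf (rateI f '' {y : Per d | y.1 ∈ cyl F a})
  have hinf : (⨅ (y : Per d) (_ : y.1 ∈ cyl F a), (rateI f y : EReal)) = (J : EReal) :=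
    iInf_coe_eq_of_isGLB hJ
  rw [iInf_rateItilde_cyl hθ0 hθ1 hf hD, hinf, ← EReal.coe_neg]
  have hnum := tendsto_log_cylMass hf hD hm0 hm ⟨y0, hy0⟩ hJ hc hs hL hcs
  have hden := tendsto_log_cylMass hf hD hm0 hm ⟨y0, Set.mem_univ _⟩
    (isGLB_rateI_univ hθ0 hθ1 hf hK) hc hs hL hcs
  have hlim := hnum.sub hden
  rw [neg_zero, sub_zero] at hlim
  refine ((continuous_coe_real_ereal.tendsto _).comp hlim).congr' ?_
  filter_upwards [hc.eventually_gt_atTop 0, hs.eventually self_mem_nhdsWithin] with i hci hsi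
  have hsum := summable_weight hD hm0 hm hci hsi
  have h1 := cylMass_pos hsum ⟨y0, hy0⟩
  have h2 := cylMass_pos hsum ⟨y0, Set.mem_univ _⟩
  rw [mu_cyl hsum, ENNReal.log_ofReal_of_pos (div_pos h1 h2), ← EReal.coe_mul,
    Real.log_div h1.ne' h2.ne', Function.comp_apply]
  congr 1
  ring

/-- Both ways of approaching `L` keep `c (1 - s)` away from `0`, and nothing more is needed. -/
theorem exists_pos_eventually_le {ι : Type*} {l : Filter ι} {u : ι → ℝ} {L : EReal} (hL : 0 < L)
    (h : Tendsto (fun i => (u i : EReal)) l (𝓝 L) ∨ liminf (fun i => (u i : EReal)) l = L) :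
    ∃ r : ℝ, 0 < r ∧ ∀ᶠ i in l, r ≤ u i := by
  obtain ⟨r, hr0, hrL⟩ := EReal.lt_iff_exists_real_btwn.1 hL
  refine ⟨r, by exact_mod_cast hr0, ?_⟩
  have : ∀ᶠ i in l, (r : EReal) < u i := by
    rcases h with h | h
    · exact h.eventually (lt_mem_nhds hrL)
    · exact eventually_lt_of_lt_liminf (h ▸ hrL)
  filter_upwards [this] with i hi
  exact_mod_cast hi.le

end ZetaShift

theorem corollary5 {d : ℕ} (hd : 1 ≤ d) {θ : ℝ} (hθ0 : 0 < θ) (hθ1 : θ < 1)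
    (f : ZetaShift.X d → ℝ) (hf : ∀ x, 0 < f x) (hfL : ZetaShift.IsLip θ f) :
    -- `μ_{c,s}` is well defined: it is the invariant probability with the prescribed integrals
    (∀ c s : ℝ, 0 < c → 0 < s → s < 1 →
      Summable (fun n : ℕ => ∑ x ∈ ZetaShift.fixSucc d n, ZetaShift.weight f c s (n + 1) x) ∧
      ZetaShift.mu f c s ∈ ZetaShift.invProb d ∧
      ∀ k : ZetaShift.X d → ℝ, Continuous k →
        ∫ x, k x ∂(ZetaShift.mu f c s) =
          (∑' n : ℕ, ∑ x ∈ ZetaShift.fixSucc d n, ZetaShift.weight f c s (n + 1) x *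
              (birkhoffSum ZetaShift.shift k (n + 1) x / ((n + 1 : ℕ) : ℝ))) /
            ∑' n : ℕ, ∑ x ∈ ZetaShift.fixSucc d n, ZetaShift.weight f c s (n + 1) x) ∧
    -- `Ĩ` is the announced limit, is non-negative and lower semicontinuous, extends `I`,
    -- and has the same infimum as `I` on every cylinder
    (∀ x, Tendsto (fun ε : ℝ => ZetaShift.infBall θ f x ε) (𝓝[>] 0)
      (𝓝 (ZetaShift.rateItilde θ f x))) ∧
    (∀ x, 0 ≤ ZetaShift.rateItilde θ f x) ∧
    LowerSemicontinuous (ZetaShift.rateItilde θ f) ∧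
    (∀ x : ZetaShift.Per d, ZetaShift.rateItilde θ f x.1 = (ZetaShift.rateI f x : EReal)) ∧
    (∀ (F : Finset ℕ) (a : ZetaShift.X d),
      (⨅ x ∈ ZetaShift.cyl F a, ZetaShift.rateItilde θ f x) =
        (⨅ (y : ZetaShift.Per d) (_ : y.1 ∈ ZetaShift.cyl F a), (ZetaShift.rateI f y : EReal))) ∧
    -- the large deviation principle on cylinders, along any family with `c → ∞`, `s → 1⁻` and
    -- `c (1 - s) → L`, or merely `liminf c (1 - s) = L`, where `0 < L ≤ ∞`
    (∀ {ι : Type*} (l : Filter ι) (c s : ι → ℝ) (L : EReal), 0 < L →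
      Tendsto c l atTop → Tendsto s l (𝓝[<] 1) →
      (Tendsto (fun i => ((c i * (1 - s i) : ℝ) : EReal)) l (𝓝 L) ∨
        liminf (fun i => ((c i * (1 - s i) : ℝ) : EReal)) l = L) →
      ∀ (F : Finset ℕ) (a : ZetaShift.X d),
        Tendsto (fun i => ((1 / c i : ℝ) : EReal) *
            ENNReal.log (ZetaShift.mu f (c i) (s i) (ZetaShift.cyl F a))) l
          (𝓝 (-(⨅ x ∈ ZetaShift.cyl F a, ZetaShift.rateItilde θ f x)))) := by

  have : NeZero d := ⟨by omega⟩
  obtain ⟨K, -, hK⟩ := hfL.exists_distortion hθ0 hθ1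
  have hcont := ZetaShift.continuous_of_distortion hθ0 hθ1 hK
  have hD : ZetaShift.Distortion f K := fun n x y h => by simpa using hK n 0 x y h
  obtain ⟨m, hm0, hm⟩ : ∃ m : ℝ, 0 < m ∧ ∀ x, m ≤ f x := by
    obtain ⟨x, -, hx⟩ := isCompact_univ.exists_isMinOn ⟨0, trivial⟩ hcont.continuousOn
    exact ⟨f x, hf x, fun y => hx trivial⟩
  refine ⟨fun c s hc _ hs => ?_, ZetaShift.tendsto_infBall θ f,
    ZetaShift.rateItilde_nonneg θ hcont, ZetaShift.lowerSemicontinuous_rateItilde hθ0 hθ1 f,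
    ZetaShift.rateItilde_eq_rateI hθ0 hθ1 hcont hD,
    ZetaShift.iInf_rateItilde_cyl hθ0 hθ1 hcont hD, ?_⟩
  · have hsum := ZetaShift.summable_weight hD hm0 hm hc hs
    exact ⟨hsum, ZetaShift.mu_mem_invProb hsum, fun k hk => ZetaShift.integral_mu hsum hk⟩
  · intro ι l c s L hL hc hs hlim F a
    obtain ⟨r, hr0, hr⟩ := ZetaShift.exists_pos_eventually_le hL hlim
    exact ZetaShift.tendsto_log_mu_cyl hθ0 hθ1 hcont hK hm0 hm hc hs hr0 hr F a
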